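/- Let $M\ge 2$ and consider $M$ bosonic modes with annihilation operators $a_1,\dots,a_M$ on $L^2(\mathbb R^M)$. For $\vec\alpha\in\mathbb C^M$ let $D(\vec\alpha)=\prod_{m}\exp(\alpha_m a_m^\dagger-\alpha_m^* a_m)$ be the displacement operator, and for a state (positive trace-class operator of trace one) $\varrho$ of one mode let $\chi_\varrho(\xi)=\operatorname{tr}[\varrho D(\xi)]$, $\xi\in\mathbb C$, be its characteristic function. A state $\rho$ of the $M$ modes is called genuinely multipartite entangled (GME) if it is not a (finite or countable) statistical mixture $$\rho=\sum_{(\mathcal A|\bar{\mathcal A})}\sum_k p_{\mathcal A}^{(k)}\,\rho_{\mathcal A}^{(k)}\otimes\rho_{\bar{\mathcal A}}^{(k)},\qquad p_{\mathcal A}^{(k)}\ge 0,\quad \sum_{(\mathcal A|\bar{\mathcal A})}\sum_k p_{\mathcal A}^{(k)}=1,$$ where $(\mathcal A|\bar{\mathcal A})$ runs over the bipartitions of the set of modes into two non-empty parts and $\rho_{\mathcal A}^{(k)}$, $\rho_{\bar{\mathcal A}}^{(k)}$ are states of the modes in $\mathcal A$, respectively $\bar{\mathcal A}$. Let $\rho$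 be a state of the $M$ modes, let $\vec y,\vec z\in\mathbb C^M$ satisfy $|y_m|^2-|z_m|^2=1$ for every $m$, let $\xi_1,\dots,\xi_N\in\mathbb C$, and let $\varrho_1,\dots,\varrho_{M-2}$ be single-mode states. Define $\mathbf C,\mathbf K\in\mathbb C^{N\times N}$ by $$[\mathbf C]_{n,n'}=\frac1N\operatorname{tr}\!\left[\rho\,D\big((\xi_n-\xi_{n'})\vec y+(\xi_n-\xi_{n'})^*\vec z\big)\right],\qquad [\mathbf K]_{n,n'}=\prod_{m=1}^{M-2}\chi_{\varrho_m}(\xi_n-\xi_{n'}).$$ If the entrywise (Hadamard) product satisfies $\|\mathbf C\circ\mathbf K\|_1>1$, where $\|\cdot\|_1$ is the trace norm (the sum of the singular values), then $\rho$ is GME. -/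

import Mathlib

open MeasureTheory
open scoped Matrix ComplexConjugate

noncomputable section

namespace PhaseSpace

/-! ### Bosonic modes, in the position (Schrödinger) representation -/

/-- The Hilbert space `L²(ℝ^ι)` of a system of bosonic modes labelled by `ι`.  The annihilation
operator of the mode `m` is `a_m = (x_m + ∂/∂x_m)/√2`. -/
abbrev ModeSpace (ι : Type) [Fintype ι] : Type :=
  Lp ℂ 2 (volume : Measure (ι → ℝ))

section Displacement

variable {ι : Type} [Fintype ι]

/-- The phase factor of the displacement operator. -/
def displacementPhase (α : ι → ℂ) (x : ι → ℝ) : ℂ :=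
  Complex.exp (((∑ m, (√2 * (α m).im * x m - (α m).re * (α m).im) : ℝ) : ℂ) * Complex.I)

theorem norm_displacementPhase (α : ι → ℂ) (x : ι → ℝ) : ‖displacementPhase α x‖ = 1 :=
  Complex.norm_exp_ofReal_mul_I _

theorem continuous_displacementPhase (α : ι → ℂ) : Continuous (displacementPhase α) := by
  unfold displacementPhase
  fun_prop

/-- The value of the displaced wave function at a point. -/
def displaceFun (α : ι → ℂ) (ψ : (ι → ℝ) → ℂ) (x : ι → ℝ) : ℂ :=
  displacementPhase α x * ψ (fun m => x m - √2 * (α m).re)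

theorem measurePreserving_shift (α : ι → ℂ) :
    MeasurePreserving (fun (x : ι → ℝ) (m : ι) => x m - √2 * (α m).re) volume volume :=
  measurePreserving_sub_right (volume : Measure (ι → ℝ)) (fun m => √2 * (α m).re)

theorem eLpNorm_displaceFun (α : ι → ℂ) (ψ : ModeSpace ι) :
    eLpNorm (displaceFun α ψ) 2 volume = eLpNorm ψ 2 volume := by
  rw [← eLpNorm_comp_measurePreserving (Lp.aestronglyMeasurable ψ) (measurePreserving_shift α)]
  refine eLpNorm_congr_norm_ae (Filter.Eventually.of_forall fun x => ?_)
  simp [displaceFun, norm_displacementPhase]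

theorem memLp_displaceFun (α : ι → ℂ) (ψ : ModeSpace ι) :
    MemLp (displaceFun α ψ) 2 volume := by
  refine ⟨?_, by rw [eLpNorm_displaceFun]; exact (Lp.memLp ψ).2⟩
  exact (continuous_displacementPhase α).aestronglyMeasurable.mul
    ((Lp.aestronglyMeasurable ψ).comp_measurePreserving (measurePreserving_shift α))

theorem displaceFun_congr (α : ι → ℂ) {f g : (ι → ℝ) → ℂ} (h : f =ᵐ[volume] g) :
    displaceFun α f =ᵐ[volume] displaceFun α g := by
  filter_upwards [(measurePreserving_shift α).quasiMeasurePreserving.ae_eq_comp h] with x hx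
  simp only [Function.comp_apply] at hx
  simp only [displaceFun, hx]

/-- The multimode displacement operator
`D(α) = ∏_m exp(α_m a_m† - α_m^* a_m) = ∏_m exp(i √2 Im(α_m) x_m - √2 Re(α_m) ∂/∂x_m)`, that is
`(D(α)ψ)(x) = exp(i ∑_m (√2 Im(α_m) x_m - Re(α_m) Im(α_m))) ψ(x - √2 Re α)`. -/
def displacement (α : ι → ℂ) : ModeSpace ι →L[ℂ] ModeSpace ι :=
  LinearMap.mkContinuous
    { toFun := fun ψ => (memLp_displaceFun α ψ).toLp _
      map_add' := fun ψ φ => by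
        rw [← MemLp.toLp_add, MemLp.toLp_eq_toLp_iff]
        refine (displaceFun_congr α (Lp.coeFn_add ψ φ)).trans
          (Filter.Eventually.of_forall fun x => ?_)
        simp [displaceFun, mul_add]
      map_smul' := fun c ψ => by
        rw [RingHom.id_apply, ← MemLp.toLp_const_smul, MemLp.toLp_eq_toLp_iff]
        refine (displaceFun_congr α (Lp.coeFn_smul c ψ)).trans
          (Filter.Eventually.of_forall fun x => ?_)
        simp only [displaceFun, Pi.smul_apply, smul_eq_mul]
        ring }
    1
    (fun ψ => by
      simp only [LinearMap.coe_mk, AddHom.coe_mk, one_mul]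
      rw [Lp.norm_toLp, eLpNorm_displaceFun, Lp.norm_def])

end Displacement

/-! ### States and characteristic functions -/

/-- The index set of some orthonormal Hilbert basis of `H`. -/
def basisSet (H : Type) [NormedAddCommGroup H] [InnerProductSpace ℂ H] [CompleteSpace H] :
    Set H :=
  (exists_hilbertBasis ℂ H).choose

/-- Some orthonormal Hilbert basis of `H`; traces do not depend on which one it is. -/
def orthoBasis (H : Type) [NormedAddCommGroup H] [InnerProductSpace ℂ H] [CompleteSpace H] :
    HilbertBasis (basisSet H) ℂ H :=
  (exists_hilbertBasis ℂ H).choose_spec.choose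

/-- The trace `∑ᵢ ⟨eᵢ, T eᵢ⟩`; it is used for trace-class operators only. -/
def opTrace {H : Type} [NormedAddCommGroup H] [InnerProductSpace ℂ H] [CompleteSpace H]
    (T : H →L[ℂ] H) : ℂ :=
  ∑' i, inner ℂ (orthoBasis H i) (T (orthoBasis H i))

/-- A state (density operator): a positive trace-class operator of trace one. -/
structure State (H : Type) [NormedAddCommGroup H] [InnerProductSpace ℂ H]
    [CompleteSpace H] where
  /-- the density operator itself -/
  op : H →L[ℂ] H
  isPositive : op.IsPositive
  trace_one : HasSum (fun i => inner ℂ (orthoBasis H i) (op (orthoBasis H i))) (1 : ℂ)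

/-- The characteristic function `χ_ρ(ξ) = tr[ρ D(ξ)]`. -/
def charFn {ι : Type} [Fintype ι] (ρ : State (ModeSpace ι)) (ξ : ι → ℂ) : ℂ :=
  opTrace (ρ.op ∘L displacement ξ)

/-! ### Genuine multipartite entanglement -/

/-- The product wave function `x ↦ f(x_A) g(x_Ā)`. -/
def tensorFun {M : ℕ} (A : Finset (Fin M)) (f : ({m // m ∈ A} → ℝ) → ℂ)
    (g : ({m // m ∉ A} → ℝ) → ℂ) (x : Fin M → ℝ) : ℂ :=
  f (fun m => x m) * g (fun m => x m)

theorem measurePreserving_split {M : ℕ} (A : Finset (Fin M)) :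
    MeasurePreserving (MeasurableEquiv.piEquivPiSubtypeProd (fun _ : Fin M => ℝ) (fun m => m ∈ A))
      (volume : Measure (Fin M → ℝ))
      ((volume : Measure ({m // m ∈ A} → ℝ)).prod (volume : Measure ({m // m ∉ A} → ℝ))) := by
  have h := volume_preserving_piEquivPiSubtypeProd (fun _ : Fin M => ℝ) (fun m => m ∈ A)
  rw [Measure.volume_eq_prod] at h
  refine ⟨h.measurable, h.map_eq.trans ?_⟩
  congr! 3

theorem memLp_tensorFun {M : ℕ} (A : Finset (Fin M)) (f : ModeSpace {m // m ∈ A})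
    (g : ModeSpace {m // m ∉ A}) : MemLp (tensorFun A f g) 2 volume := by
  have hf := Lp.memLp f
  have hg := Lp.memLp g
  have key : MemLp (fun q : ({m // m ∈ A} → ℝ) × ({m // m ∉ A} → ℝ) => f q.1 * g q.2) 2
      (volume.prod volume) := by
    have hm : AEStronglyMeasurable
        (fun q : ({m // m ∈ A} → ℝ) × ({m // m ∉ A} → ℝ) => f q.1 * g q.2)
        (volume.prod volume) := hf.1.comp_fst.mul hg.1.comp_snd
    rw [memLp_two_iff_integrable_sq_norm hm]
    have h := ((memLp_two_iff_integrable_sq_norm hf.1).1 hf).mul_prod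
      ((memLp_two_iff_integrable_sq_norm hg.1).1 hg)
    simpa [mul_pow] using h
  exact key.comp_measurePreserving (measurePreserving_split A)

/-- The product vector `f ⊗ g`, under the identification of `L²(ℝ^A) ⊗ L²(ℝ^Ā)` with
`L²(ℝ^M)`. -/
def tensorVec {M : ℕ} (A : Finset (Fin M)) (f : ModeSpace {m // m ∈ A})
    (g : ModeSpace {m // m ∉ A}) : ModeSpace (Fin M) :=
  (memLp_tensorFun A f g).toLp _

/-- `ω = σ ⊗ τ` with `σ` a state of the modes in `A` and `τ` a state of the other modes.  Product
vectors span a dense subspace, so that `σ` and `τ` determine `ω`. -/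
def IsProductState {M : ℕ} (A : Finset (Fin M)) (σ : State (ModeSpace {m // m ∈ A}))
    (τ : State (ModeSpace {m // m ∉ A})) (ω : State (ModeSpace (Fin M))) : Prop :=
  ∀ f g, ω.op (tensorVec A f g) = tensorVec A (σ.op f) (τ.op g)

/-- The bipartitions `(A | Ā)` of the `M` modes into two non-empty parts. -/
abbrev Bipartition (M : ℕ) : Type :=
  {A : Finset (Fin M) // A.Nonempty ∧ Aᶜ.Nonempty}

/-- A statistical mixture `∑_A ∑_k p_A^(k) σ_A^(k) ⊗ τ_Ā^(k)` of states that are products with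
respect to some bipartition, which may vary from term to term. -/
def IsBiseparableMixture {M : ℕ} (ρ : State (ModeSpace (Fin M))) : Prop :=
  ∃ (p : Bipartition M × ℕ → ℝ)
    (σ : ∀ j : Bipartition M × ℕ, State (ModeSpace {m // m ∈ j.1.1}))
    (τ : ∀ j : Bipartition M × ℕ, State (ModeSpace {m // m ∉ j.1.1}))
    (ω : Bipartition M × ℕ → State (ModeSpace (Fin M))),
    (∀ j, 0 ≤ p j) ∧ HasSum p 1 ∧
    (∀ j, IsProductState j.1.1 (σ j) (τ j) (ω j)) ∧
    HasSum (fun j => (p j : ℂ) • (ω j).op) ρ.op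

/-- Genuine multipartite entanglement. -/
def IsGME {M : ℕ} (ρ : State (ModeSpace (Fin M))) : Prop :=
  ¬ IsBiseparableMixture ρ

/-! ### The measured matrix and the kernel matrix -/

/-- The trace norm of a matrix: the sum of its singular values, which are the square roots of
the eigenvalues of `Aᴴ * A`. -/
def traceNorm {N : ℕ} (A : Matrix (Fin N) (Fin N) ℂ) : ℝ :=
  ∑ i, √((Matrix.isHermitian_conjTranspose_mul_self A).eigenvalues i)

/-- `C_{n,n'} = (1/N) tr[ρ D((ξ_n - ξ_n') y + (ξ_n - ξ_n')^* z)]`. -/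
def measuredMatrix {M N : ℕ} (ρ : State (ModeSpace (Fin M))) (y z : Fin M → ℂ)
    (ξ : Fin N → ℂ) : Matrix (Fin N) (Fin N) ℂ :=
  Matrix.of fun n n' =>
    (1 / (N : ℂ)) * charFn ρ (fun m => (ξ n - ξ n') * y m + conj (ξ n - ξ n') * z m)

/-- `K_{n,n'} = ∏_j χ_{ϱ_j}(ξ_n - ξ_n')` for single-mode states `ϱ_j`. -/
def kernelMatrix {L N : ℕ} (r : Fin L → State (ModeSpace (Fin 1))) (ξ : Fin N → ℂ) :
    Matrix (Fin N) (Fin N) ℂ :=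
  Matrix.of fun n n' => ∏ j, charFn (r j) (fun _ => ξ n - ξ n')

end PhaseSpace

end

noncomputable section

namespace PhaseSpace

/-! ### Traces against a state -/

/-! For a biseparable mixture the matrix `C ∘ K` is positive semidefinite. Its trace norm is then
its trace, which is at most 1 because characteristic functions equal 1 at the origin; this is the
contrapositive of the claim.

Positivity comes from the quantum Bochner theorem. By the Weyl relations, `exp(∓ i s(αₙ, αₙ'))`
times `χ(αₙ - αₙ')` is a positive semidefinite matrix for either sign, `s` being the symplectic form
(`posSemidef_charFn`, `posSemidef_charFn'`). For a product across `(A | Ā)` the characteristic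
function factorises (`IsProductState.charFn_eq`). At the points `ξ y + ξ^* z`, the condition `|y|² -
|z|² = 1` makes every mode contribute the same phase (`symplecticForm_bogoliubov`). Take sign `-` on
`A`, sign `+` on `Ā`, and `|Ā| - 1` minus and `|A| - 1` plus signs on the `M - 2` single-mode
kernels. All phases cancel, so `C ∘ K` is a Hadamard product of positive semidefinite matrices, up
to the factor `1/N`, and the Schur product theorem applies. One list of kernels thus serves every
bipartition, and mixtures follow by convexity (`hasSum_charFn_of_hasSum`).

The rest is trace-class analysis, reduced to the Hilbert–Schmidt operator `√ρ`. -/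

theorem inner_self_eq_ofReal_norm_sq {E : Type} [NormedAddCommGroup E]
    [InnerProductSpace ℂ E] (x : E) : inner ℂ x x = ((‖x‖ ^ 2 : ℝ) : ℂ) := by
  rw [inner_self_eq_norm_sq_to_K]
  norm_cast

section Trace

variable {H : Type} [NormedAddCommGroup H] [InnerProductSpace ℂ H] [CompleteSpace H]

theorem exists_symmetric_sqrt {T : H →L[ℂ] H} (hT : T.IsPositive) :
    ∃ S : H →L[ℂ] H, ContinuousLinearMap.adjoint S = S ∧ S ∘L S = T := by
  have h0 : 0 ≤ T := (ContinuousLinearMap.nonneg_iff_isPositive T).2 hT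
  refine ⟨CFC.sqrt T, ?_, CFC.sqrt_mul_sqrt_self T h0⟩
  exact (IsSelfAdjoint.of_nonneg (CFC.sqrt_nonneg T)).star_eq

/-- Parseval's identity for Hilbert–Schmidt operators, computed in two different bases. -/
theorem exists_hasSum_inner_adjoint {ι κ : Type} (b : HilbertBasis ι ℂ H)
    (f : HilbertBasis κ ℂ H) (X Y : H →L[ℂ] H) (hX : Summable fun i => ‖X (b i)‖ ^ 2)
    (hY : Summable fun i => ‖Y (b i)‖ ^ 2) :
    ∃ s : ℂ, HasSum (fun i => inner ℂ (X (b i)) (Y (b i))) s ∧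
      HasSum (fun k => inner ℂ (ContinuousLinearMap.adjoint Y (f k))
        (ContinuousLinearMap.adjoint X (f k))) s := by
  have parseval : ∀ v : H, HasSum (fun k => ‖inner ℂ v (f k)‖ ^ 2) (‖v‖ ^ 2) := fun v => by
    have h := f.hasSum_inner_mul_inner v v
    have h1 : ∀ k, inner ℂ v (f k) * inner ℂ (f k) v = ((‖inner ℂ v (f k)‖ ^ 2 : ℝ) : ℂ) :=
      fun k => by
        rw [← inner_conj_symm (f k) v, Complex.mul_conj, Complex.normSq_eq_norm_sq]
    simp only [h1, inner_self_eq_ofReal_norm_sq] at h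
    exact Complex.hasSum_ofReal.1 h
  have key : ∀ Z : H →L[ℂ] H, Summable (fun i => ‖Z (b i)‖ ^ 2) →
      Summable fun q : ι × κ => ‖inner ℂ (Z (b q.1)) (f q.2)‖ ^ 2 := fun Z hZ => by
    rw [summable_prod_of_nonneg fun q => by positivity]
    refine ⟨fun i => (parseval (Z (b i))).summable, ?_⟩
    simpa only [(parseval _).tsum_eq] using hZ
  -- Domination by the two square-summable families allows the double sum to be taken in either
  -- order; the two orders give the two claims.
  have hF : Summable fun q : ι × κ =>
      inner ℂ (X (b q.1)) (f q.2) * inner ℂ (f q.2) (Y (b q.1)) := by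
    refine Summable.of_norm_bounded ((key X hX).add (key Y hY)) fun q => ?_
    rw [norm_mul, norm_inner_symm (f q.2)]
    nlinarith [sq_nonneg (‖inner ℂ (X (b q.1)) (f q.2)‖ - ‖inner ℂ (Y (b q.1)) (f q.2)‖),
      sq_nonneg (‖inner ℂ (X (b q.1)) (f q.2)‖), sq_nonneg (‖inner ℂ (Y (b q.1)) (f q.2)‖)]
  obtain ⟨s, hs⟩ := hF
  refine ⟨s, hs.prod_fiberwise fun i => f.hasSum_inner_mul_inner (X (b i)) (Y (b i)), ?_⟩
  have hs' : HasSum (fun q : κ × ι =>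
      inner ℂ (ContinuousLinearMap.adjoint Y (f q.1)) (b q.2) *
        inner ℂ (b q.2) (ContinuousLinearMap.adjoint X (f q.1))) s := by
    have h := (Equiv.prodComm κ ι).hasSum_iff.2 hs
    refine h.congr_fun fun q => ?_
    rw [ContinuousLinearMap.adjoint_inner_left, ContinuousLinearMap.adjoint_inner_right, mul_comm]
    rfl
  exact hs'.prod_fiberwise fun k => b.hasSum_inner_mul_inner
    (ContinuousLinearMap.adjoint Y (f k)) (ContinuousLinearMap.adjoint X (f k))

theorem hasSum_norm_sq_adjoint {ι κ : Type} (b : HilbertBasis ι ℂ H)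
    (f : HilbertBasis κ ℂ H) (X : H →L[ℂ] H) {s : ℝ} (hX : HasSum (fun i => ‖X (b i)‖ ^ 2) s) :
    HasSum (fun k => ‖ContinuousLinearMap.adjoint X (f k)‖ ^ 2) s := by
  obtain ⟨t, h1, h2⟩ := exists_hasSum_inner_adjoint b f X X hX.summable hX.summable
  have hs : t = (s : ℂ) := by
    refine h1.unique ?_
    convert Complex.hasSum_ofReal.2 hX using 2 with i
    rw [inner_self_eq_norm_sq_to_K]; norm_cast
  rw [hs] at h2
  rw [← Complex.hasSum_ofReal]
  convert h2 using 2 with k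
  rw [inner_self_eq_norm_sq_to_K]; norm_cast

/-- `trace_one` refers to one fixed basis. Passing to the Hilbert–Schmidt norm of `√ρ` removes that
dependence. -/
theorem State.exists_factor (ρ : State H) :
    ∃ S : H →L[ℂ] H, ContinuousLinearMap.adjoint S = S ∧ S ∘L S = ρ.op ∧
      ∀ {ι : Type} (b : HilbertBasis ι ℂ H), HasSum (fun i => ‖S (b i)‖ ^ 2) 1 := by
  obtain ⟨S, hS, hSS⟩ := exists_symmetric_sqrt ρ.isPositive
  refine ⟨S, hS, hSS, fun b => ?_⟩
  have h : HasSum (fun i => ‖S (orthoBasis H i)‖ ^ 2) 1 := by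
    rw [← Complex.hasSum_ofReal, Complex.ofReal_one]
    convert ρ.trace_one using 2 with i
    rw [← hSS, ContinuousLinearMap.comp_apply, ← ContinuousLinearMap.adjoint_inner_left, hS,
      inner_self_eq_norm_sq_to_K]
    norm_cast
  simpa only [hS] using hasSum_norm_sq_adjoint _ b S h

/-- With `S = √ρ`, the trace of `ρ T` in any basis equals `∑ₖ ⟨S eₖ, T S eₖ⟩`. -/
theorem State.exists_sqrt_hasSum (ρ : State H) :
    ∃ S : H →L[ℂ] H, ContinuousLinearMap.adjoint S = S ∧ S ∘L S = ρ.op ∧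
      (∀ {ι : Type} (b : HilbertBasis ι ℂ H), HasSum (fun i => ‖S (b i)‖ ^ 2) 1) ∧
      ∀ T : H →L[ℂ] H,
        (∃ s ≤ ‖T‖ ^ 2, ∀ {ι : Type} (b : HilbertBasis ι ℂ H),
          HasSum (fun i => ‖S (T (b i))‖ ^ 2) s) ∧
        HasSum (fun i => inner ℂ (S (orthoBasis H i)) (T (S (orthoBasis H i))))
          (opTrace (ρ.op ∘L T)) ∧
        ∀ {ι : Type} (b : HilbertBasis ι ℂ H),
          HasSum (fun i => inner ℂ (b i) (ρ.op (T (b i)))) (opTrace (ρ.op ∘L T)) := by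
  obtain ⟨S, hS, hSS, hsum⟩ := ρ.exists_factor
  refine ⟨S, hS, hSS, hsum, fun T => ?_⟩
  -- `S T` is estimated through its adjoint `T† S`, where the norm of `T` can be pulled out on the
  -- left.
  have hbd : ∀ i, ‖(ContinuousLinearMap.adjoint T ∘L S) (orthoBasis H i)‖ ^ 2 ≤
      ‖T‖ ^ 2 * ‖S (orthoBasis H i)‖ ^ 2 := fun i => by
    rw [← mul_pow]
    refine pow_le_pow_left₀ (norm_nonneg _) ?_ 2
    refine ((ContinuousLinearMap.adjoint T).le_opNorm _).trans_eq ?_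
    rw [LinearIsometryEquiv.norm_map]
    rfl
  have hs1 : Summable fun i => ‖(ContinuousLinearMap.adjoint T ∘L S) (orthoBasis H i)‖ ^ 2 :=
    Summable.of_nonneg_of_le (fun i => by positivity) hbd ((hsum (orthoBasis H)).summable.mul_left _)
  have hadj : ContinuousLinearMap.adjoint (ContinuousLinearMap.adjoint T ∘L S) = S ∘L T := by
    rw [ContinuousLinearMap.adjoint_comp, ContinuousLinearMap.adjoint_adjoint, hS]
  have hST : ∀ {ι : Type} (b : HilbertBasis ι ℂ H), HasSum (fun i => ‖S (T (b i))‖ ^ 2)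
      (∑' i, ‖(ContinuousLinearMap.adjoint T ∘L S) (orthoBasis H i)‖ ^ 2) := fun b => by
    simpa only [hadj, ContinuousLinearMap.comp_apply] using
      hasSum_norm_sq_adjoint (orthoBasis H) b _ hs1.hasSum
  have hdiag : ∀ {ι : Type} (b : HilbertBasis ι ℂ H),
      ∃ s, HasSum (fun i => inner ℂ (b i) (ρ.op (T (b i)))) s ∧
        HasSum (fun i => inner ℂ (S (orthoBasis H i)) (T (S (orthoBasis H i)))) s := fun b => by
    obtain ⟨s, h1, h2⟩ := exists_hasSum_inner_adjoint b (orthoBasis H) S (S ∘L T)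
      (hsum b).summable (hST b).summable
    refine ⟨s, ?_, ?_⟩
    · convert h1 using 2 with i
      rw [← hSS, ContinuousLinearMap.comp_apply, ContinuousLinearMap.comp_apply,
        ← ContinuousLinearMap.adjoint_inner_left, hS]
    · convert h2 using 2 with i
      rw [ContinuousLinearMap.adjoint_comp, hS, ContinuousLinearMap.comp_apply,
        ContinuousLinearMap.adjoint_inner_left]
  have htr : HasSum (fun i => inner ℂ (S (orthoBasis H i)) (T (S (orthoBasis H i))))
      (opTrace (ρ.op ∘L T)) := by
    obtain ⟨s, h1, h2⟩ := hdiag (orthoBasis H)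
    have h3 : opTrace (ρ.op ∘L T) = s := h1.tsum_eq
    rwa [h3]
  refine ⟨⟨_, ?_, hST⟩, htr, fun b => ?_⟩
  · refine (hs1.tsum_le_tsum hbd ((hsum (orthoBasis H)).summable.mul_left _)).trans_eq ?_
    rw [tsum_mul_left, (hsum (orthoBasis H)).tsum_eq, mul_one]
  · obtain ⟨s, h1, h2⟩ := hdiag b
    rwa [htr.unique h2]

theorem State.hasSum_opTrace (ρ : State H) (T : H →L[ℂ] H) {ι : Type} (b : HilbertBasis ι ℂ H) :
    HasSum (fun i => inner ℂ (b i) (ρ.op (T (b i)))) (opTrace (ρ.op ∘L T)) := by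
  obtain ⟨S, -, -, -, h⟩ := ρ.exists_sqrt_hasSum
  exact (h T).2.2 b

theorem State.opTrace_comp_id (ρ : State H) :
    opTrace (ρ.op ∘L ContinuousLinearMap.id ℂ H) = 1 :=
  ρ.trace_one.tsum_eq

theorem State.inner_op_right (ρ : State H) (x y : H) :
    inner ℂ x (ρ.op y) = inner ℂ (ρ.op x) y :=
  (ρ.isPositive.inner_left_eq_inner_right x y).symm

/-- The vectors `√ρ eᵢ` form an unnormalised pure-state ensemble for `ρ`, so positivity questions
reduce to single vectors. -/
theorem State.exists_vectors (ρ : State H) :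
    ∃ v : basisSet H → H, ∀ T : H →L[ℂ] H,
      HasSum (fun i => inner ℂ (v i) (T (v i))) (opTrace (ρ.op ∘L T)) := by
  obtain ⟨S, -, -, -, h⟩ := ρ.exists_sqrt_hasSum
  exact ⟨fun i => S (orthoBasis H i), fun T => (h T).2.1⟩

/-- The terms are `⟨S b, S T b⟩` with `S = √ρ`, bounded by the sum of the squared norms. The bound
does not depend on the state, which later justifies exchanging a mixture with a trace. -/
theorem State.summable_norm_inner (ρ : State H) (T : H →L[ℂ] H) {ι : Type}
    (b : HilbertBasis ι ℂ H) :
    Summable (fun i => ‖inner ℂ (b i) (ρ.op (T (b i)))‖) ∧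
      ∑' i, ‖inner ℂ (b i) (ρ.op (T (b i)))‖ ≤ 1 + ‖T‖ ^ 2 := by
  obtain ⟨S, hS, hSS, hsum, h⟩ := ρ.exists_sqrt_hasSum
  obtain ⟨s, hs, hsT⟩ := (h T).1
  have hle : ∀ i, ‖inner ℂ (b i) (ρ.op (T (b i)))‖ ≤ ‖S (b i)‖ ^ 2 + ‖S (T (b i))‖ ^ 2 :=
    fun i => by
      rw [← hSS, ContinuousLinearMap.comp_apply, ← ContinuousLinearMap.adjoint_inner_left, hS]
      refine (norm_inner_le_norm _ _).trans ?_
      nlinarith [sq_nonneg (‖S (b i)‖ - ‖S (T (b i))‖), sq_nonneg ‖S (b i)‖,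
        sq_nonneg ‖S (T (b i))‖]
  have hsm := (hsum b).add (hsT b)
  have hsmm := Summable.of_nonneg_of_le (fun i => norm_nonneg _) hle hsm.summable
  refine ⟨hsmm, ?_⟩
  refine (hsmm.tsum_le_tsum hle hsm.summable).trans ?_
  rw [hsm.tsum_eq]
  linarith

theorem State.eq_zero_of_inner_eq_zero (ρ : State H) {x : H} (hx : inner ℂ x (ρ.op x) = 0) :
    ρ.op x = 0 := by
  obtain ⟨S, hS, hSS, -⟩ := ρ.exists_factor
  rw [← hSS, ContinuousLinearMap.comp_apply, ← ContinuousLinearMap.adjoint_inner_left, hS,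
    inner_self_eq_zero] at hx
  rw [← hSS, ContinuousLinearMap.comp_apply, hx, map_zero]

theorem State.hasSum_opTrace_mul {K : Type} [NormedAddCommGroup K] [InnerProductSpace ℂ K]
    [CompleteSpace K] (σ : State H) (τ : State K) (S : H →L[ℂ] H) (T : K →L[ℂ] K) {ι κ : Type}
    (b : HilbertBasis ι ℂ H) (c : HilbertBasis κ ℂ K) :
    HasSum (fun q : ι × κ =>
      inner ℂ (σ.op (b q.1)) (S (b q.1)) * inner ℂ (τ.op (c q.2)) (T (c q.2)))
      (opTrace (σ.op ∘L S) * opTrace (τ.op ∘L T)) := by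
  have hf := σ.hasSum_opTrace S b
  have hg := τ.hasSum_opTrace T c
  have hfg := summable_mul_of_summable_norm
    (f := fun i => inner ℂ (b i) (σ.op (S (b i)))) (g := fun k => inner ℂ (c k) (τ.op (T (c k))))
    (σ.summable_norm_inner S b).1 (τ.summable_norm_inner T c).1
  refine (hf.mul hg hfg).congr_fun fun q => ?_
  exact congrArg₂ (· * ·) (σ.inner_op_right (b q.1) (S (b q.1))).symm
    (τ.inner_op_right (c q.2) (T (c q.2))).symm

/-- If the diagonal entries of a state along an orthonormal family already sum up to one, traces
can be computed along that family. -/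
theorem State.hasSum_opTrace_of_orthonormal (ρ : State H) (T : H →L[ℂ] H) {κ : Type} {v : κ → H}
    (hv : Orthonormal ℂ v) (h1 : HasSum (fun q => inner ℂ (v q) (ρ.op (v q))) 1) :
    HasSum (fun q => inner ℂ (ρ.op (v q)) (T (v q))) (opTrace (ρ.op ∘L T)) := by
  obtain ⟨w, b, hsub, hb⟩ := hv.toSubtypeRange.exists_hilbertBasis_extension
  let g : κ → w := fun q => ⟨v q, hsub ⟨q, rfl⟩⟩
  have hg : Function.Injective g := fun p q hpq =>
    hv.linearIndependent.injective (congrArg Subtype.val hpq)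
  have hbg : ∀ q, b (g q) = v q := fun q => by rw [hb]
  obtain ⟨S, hS, hSS, hsum⟩ := ρ.exists_factor
  have hSx : ∀ x, inner ℂ x (ρ.op x) = ((‖S x‖ ^ 2 : ℝ) : ℂ) := fun x => by
    rw [← hSS, ContinuousLinearMap.comp_apply, ← ContinuousLinearMap.adjoint_inner_left, hS,
      inner_self_eq_ofReal_norm_sq]
  -- The given family already exhausts the trace, so the nonnegative diagonal entries at the added
  -- basis vectors vanish, and with them `ρ b`.
  have hzero : ∀ i : w, i ∉ Set.range g → ρ.op (b i) = 0 := fun i hi => by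
    simp only [hSx, ← Complex.ofReal_one, Complex.hasSum_ofReal] at h1
    have h2 : HasSum ((Set.range g).indicator fun i => ‖S (b i)‖ ^ 2) 1 := by
      rw [← hg.hasSum_iff fun i hi => Set.indicator_of_notMem hi _]
      simpa only [Function.comp_def, Set.indicator_of_mem (Set.mem_range_self _), hbg] using h1
    have h3 := (hsum b).sub h2
    rw [sub_self, hasSum_zero_iff_of_nonneg fun j => sub_nonneg.2
      (Set.indicator_le_self' (f := fun i => ‖S (b i)‖ ^ 2) (fun _ _ => by positivity) j)] at h3
    have h4 := congrFun h3 i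
    simp only [Set.indicator_of_notMem hi, sub_zero, Pi.zero_apply] at h4
    refine ρ.eq_zero_of_inner_eq_zero ?_
    rw [hSx, h4, Complex.ofReal_zero]
  have h2 := ρ.hasSum_opTrace T b
  replace h2 := h2.congr_fun fun i => (ρ.inner_op_right (b i) (T (b i))).symm
  have h3 := (hg.hasSum_iff (f := fun i => inner ℂ (ρ.op (b i)) (T (b i))) fun i hi => by
    rw [hzero i hi, inner_zero_left]).2 h2
  simpa only [Function.comp_def, hbg] using h3

end Trace

/-! ### Weyl relations -/

section Weyl

open scoped ComplexOrder

variable {ι : Type} [Fintype ι]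

theorem coeFn_displacement (α : ι → ℂ) (ψ : ModeSpace ι) :
    displacement α ψ =ᵐ[volume] displaceFun α ψ :=
  (memLp_displaceFun α ψ).coeFn_toLp

theorem norm_displacement (α : ι → ℂ) (ψ : ModeSpace ι) : ‖displacement α ψ‖ = ‖ψ‖ := by
  have h : displacement α ψ = (memLp_displaceFun α ψ).toLp _ := rfl
  rw [h, Lp.norm_toLp, eLpNorm_displaceFun, Lp.norm_def]

theorem inner_displacement (α : ι → ℂ) (ψ φ : ModeSpace ι) :
    inner ℂ (displacement α ψ) (displacement α φ) = inner ℂ ψ φ :=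
  LinearIsometry.inner_map_map
    (⟨(displacement α).toLinearMap, norm_displacement α⟩ : ModeSpace ι →ₗᵢ[ℂ] ModeSpace ι) ψ φ

theorem opNorm_displacement_le (α : ι → ℂ) : ‖displacement α‖ ≤ 1 :=
  ContinuousLinearMap.opNorm_le_bound _ zero_le_one fun ψ => by
    rw [norm_displacement, one_mul]

/-- The symplectic form `∑ₘ Im(αₘ βₘ^*)`. -/
def symplecticForm (α β : ι → ℂ) : ℝ :=
  ∑ m, ((α m).im * (β m).re - (α m).re * (β m).im)

theorem displacement_zero (ψ : ModeSpace ι) : displacement (0 : ι → ℂ) ψ = ψ := by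
  refine Lp.ext ((coeFn_displacement 0 ψ).trans (Filter.Eventually.of_forall fun x => ?_))
  simp [displaceFun, displacementPhase]

theorem displacement_displacement (α β : ι → ℂ) (ψ : ModeSpace ι) :
    displacement α (displacement β ψ) =
      Complex.exp (symplecticForm α β * Complex.I) • displacement (α + β) ψ := by
  refine Lp.ext ?_
  have h1 := (coeFn_displacement α (displacement β ψ)).trans
    (displaceFun_congr α (coeFn_displacement β ψ))
  have h2 := Lp.coeFn_smul (Complex.exp (symplecticForm α β * Complex.I))
    (displacement (α + β) ψ)
  filter_upwards [h1, h2, coeFn_displacement (α + β) ψ] with x hx1 hx2 hx3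
  rw [hx1, hx2, Pi.smul_apply, hx3, smul_eq_mul]
  have harg : (fun m => x m - √2 * (α m).re - √2 * (β m).re) =
      fun m => x m - √2 * ((α + β) m).re := by
    funext m
    simp only [Pi.add_apply, Complex.add_re]
    ring
  simp only [displaceFun, harg, ← mul_assoc]
  congr 1
  simp only [displacementPhase]
  rw [← Complex.exp_add, ← Complex.exp_add, ← add_mul, ← add_mul, ← Complex.ofReal_add,
    ← Complex.ofReal_add, symplecticForm, ← Finset.sum_add_distrib, ← Finset.sum_add_distrib]
  congr 4
  funext m
  simp only [Pi.add_apply, Complex.add_re, Complex.add_im]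
  have h2 : √2 * √2 = 2 := Real.mul_self_sqrt (by norm_num)
  linear_combination (-(α m).re * (β m).im) * h2

/-- Apply the isometry `D(α)` to both arguments: the left one returns to `ψ`, the right one becomes
a phase times `D(α - β) ψ`. -/
theorem inner_displacement_neg (α β : ι → ℂ) (ψ : ModeSpace ι) :
    inner ℂ (displacement (-α) ψ) (displacement (-β) ψ) =
      Complex.exp (-symplecticForm α β * Complex.I) * inner ℂ ψ (displacement (α - β) ψ) := by
  have h0 : symplecticForm α (-α) = 0 := by
    simp [symplecticForm, mul_comm]
  have h1 : symplecticForm α (-β) = -symplecticForm α β := by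
    simp only [symplecticForm, ← Finset.sum_neg_distrib]
    refine Finset.sum_congr rfl fun m _ => ?_
    simp only [Pi.neg_apply, Complex.neg_re, Complex.neg_im]
    ring
  rw [← inner_displacement α, displacement_displacement, displacement_displacement, h0, h1,
    add_neg_cancel, displacement_zero, ← sub_eq_add_neg, inner_smul_right]
  simp

theorem charFn_zero (ρ : State (ModeSpace ι)) : charFn ρ 0 = 1 := by
  have h : ρ.op ∘L displacement 0 = ρ.op := ContinuousLinearMap.ext fun ψ => by
    rw [ContinuousLinearMap.comp_apply, displacement_zero]
  rw [charFn, h]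
  exact ρ.trace_one.tsum_eq

/-! ### Positivity of twisted characteristic functions -/

/-- The positive semidefinite cone is closed under entrywise convergent sums. -/
theorem posSemidef_of_hasSum {N : ℕ} {κ : Type} {G : κ → Matrix (Fin N) (Fin N) ℂ}
    {A : Matrix (Fin N) (Fin N) ℂ} (hG : ∀ k, (G k).PosSemidef)
    (hA : ∀ n n', HasSum (fun k => G k n n') (A n n')) : A.PosSemidef := by
  rw [Matrix.posSemidef_iff_dotProduct_mulVec]
  refine ⟨Matrix.IsHermitian.ext fun n n' => ?_, fun x => ?_⟩
  · refine ((hA n' n).star.unique ?_)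
    simpa only [(hG _).isHermitian.apply] using hA n n'
  · have h : HasSum (fun k => star x ⬝ᵥ (G k) *ᵥ x) (star x ⬝ᵥ A *ᵥ x) := by
      simp only [dotProduct, Matrix.mulVec, Finset.mul_sum]
      exact hasSum_sum fun n _ => hasSum_sum fun n' _ => ((hA n n').mul_right _).mul_left _
    have hre := Complex.hasSum_re h
    have him := Complex.hasSum_im h
    have hk := fun k => Complex.le_def.1 ((hG k).dotProduct_mulVec_nonneg x)
    refine Complex.le_def.2 ⟨hre.nonneg fun k => (hk k).1, ?_⟩
    have hz : ∀ k, (star x ⬝ᵥ (G k) *ᵥ x).im = 0 := fun k => (hk k).2.symm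
    simp only [hz] at him
    exact hasSum_zero.unique him

/-- For each ensemble vector `v` the matrix is the Gram matrix of the vectors `D(-αₙ) v`. -/
theorem posSemidef_charFn (ρ : State (ModeSpace ι)) {N : ℕ} (α : Fin N → ι → ℂ) :
    (Matrix.of fun n n' => Complex.exp (-symplecticForm (α n) (α n') * Complex.I) *
      charFn ρ (α n - α n')).PosSemidef := by
  obtain ⟨v, hv⟩ := ρ.exists_vectors
  refine posSemidef_of_hasSum
    (fun k => Matrix.posSemidef_gram ℂ fun n => displacement (-(α n)) (v k)) fun n n' => ?_
  simp only [Matrix.gram_apply, inner_displacement_neg, Matrix.of_apply]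
  exact (hv (displacement (α n - α n'))).mul_left _

theorem symplecticForm_neg_swap (α β : ι → ℂ) :
    symplecticForm (-β) (-α) = -symplecticForm α β := by
  simp only [symplecticForm, ← Finset.sum_neg_distrib]
  refine Finset.sum_congr rfl fun m _ => ?_
  simp only [Pi.neg_apply, Complex.neg_re, Complex.neg_im]
  ring

/-- Transposition preserves positivity. Combined with `α ↦ -α` it keeps the differences `αₙ - αₙ'`
and reverses the sign of the phase. -/
theorem posSemidef_charFn' (ρ : State (ModeSpace ι)) {N : ℕ} (α : Fin N → ι → ℂ) :
    (Matrix.of fun n n' => Complex.exp (symplecticForm (α n) (α n') * Complex.I) *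
      charFn ρ (α n - α n')).PosSemidef := by
  have h := (posSemidef_charFn ρ fun n => -(α n)).transpose
  refine (congrArg Matrix.PosSemidef (Matrix.ext fun n n' => ?_)).mp h
  simp only [Matrix.of_apply, Matrix.transpose_apply, symplecticForm_neg_swap]
  rw [neg_sub_neg, Complex.ofReal_neg, neg_neg]

end Weyl

/-! ### Product vectors and product states -/

section Tensor

variable {M : ℕ} (A : Finset (Fin M))

theorem quasiMeasurePreserving_restrict_mem :
    Measure.QuasiMeasurePreserving
      (fun (x : Fin M → ℝ) (m : {m // m ∈ A}) => x m) volume volume :=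
  Measure.quasiMeasurePreserving_fst.comp (measurePreserving_split A).quasiMeasurePreserving

theorem quasiMeasurePreserving_restrict_notMem :
    Measure.QuasiMeasurePreserving
      (fun (x : Fin M → ℝ) (m : {m // m ∉ A}) => x m) volume volume :=
  Measure.quasiMeasurePreserving_snd.comp (measurePreserving_split A).quasiMeasurePreserving

theorem tensorFun_congr {f f' : ({m // m ∈ A} → ℝ) → ℂ} {g g' : ({m // m ∉ A} → ℝ) → ℂ}
    (hf : f =ᵐ[volume] f') (hg : g =ᵐ[volume] g') :
    tensorFun A f g =ᵐ[volume] tensorFun A f' g' := by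
  filter_upwards [(quasiMeasurePreserving_restrict_mem A).ae_eq_comp hf,
    (quasiMeasurePreserving_restrict_notMem A).ae_eq_comp hg] with x hx hy
  simp only [Function.comp_apply] at hx hy
  simp only [tensorFun, hx, hy]

theorem coeFn_tensorVec (f : ModeSpace {m // m ∈ A}) (g : ModeSpace {m // m ∉ A}) :
    tensorVec A f g =ᵐ[volume] tensorFun A f g :=
  (memLp_tensorFun A f g).coeFn_toLp

theorem inner_tensorVec (f f' : ModeSpace {m // m ∈ A}) (g g' : ModeSpace {m // m ∉ A}) :
    inner ℂ (tensorVec A f g) (tensorVec A f' g') = inner ℂ f f' * inner ℂ g g' := by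
  simp only [L2.inner_def]
  rw [← integral_prod_mul, ← (measurePreserving_split A).integral_comp'
    (g := fun q : ({m // m ∈ A} → ℝ) × ({m // m ∉ A} → ℝ) =>
      inner ℂ (f q.1) (f' q.1) * inner ℂ (g q.2) (g' q.2))]
  refine integral_congr_ae ?_
  filter_upwards [coeFn_tensorVec A f g, coeFn_tensorVec A f' g'] with x hx hy
  rw [hx, hy]
  simp only [tensorFun, RCLike.inner_apply, map_mul]
  exact mul_mul_mul_comm _ _ _ _

theorem displacement_tensorVec (α : Fin M → ℂ) (f : ModeSpace {m // m ∈ A})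
    (g : ModeSpace {m // m ∉ A}) :
    displacement α (tensorVec A f g) =
      tensorVec A (displacement (fun m : {m // m ∈ A} => α m) f)
        (displacement (fun m : {m // m ∉ A} => α m) g) := by
  refine Lp.ext ?_
  have h1 := (coeFn_displacement α (tensorVec A f g)).trans
    (displaceFun_congr α (coeFn_tensorVec A f g))
  have h2 := (coeFn_tensorVec A (displacement (fun m : {m // m ∈ A} => α m) f)
    (displacement (fun m : {m // m ∉ A} => α m) g)).trans
      (tensorFun_congr A (coeFn_displacement _ f) (coeFn_displacement _ g))
  refine h1.trans (Filter.EventuallyEq.trans (Filter.Eventually.of_forall fun x => ?_) h2.symm)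
  have hph : displacementPhase α x =
      displacementPhase (fun m : {m // m ∈ A} => α m) (fun m => x m) *
        displacementPhase (fun m : {m // m ∉ A} => α m) (fun m => x m) := by
    simp only [displacementPhase]
    rw [← Complex.exp_add, ← add_mul, ← Complex.ofReal_add, ← Fintype.sum_subtype_add_sum_subtype
      (fun m => m ∈ A) fun m => √2 * (α m).im * x m - (α m).re * (α m).im]
    congr!
  simp only [displaceFun, tensorFun, hph]
  exact mul_mul_mul_comm _ _ _ _

theorem orthonormal_tensorVec {ι κ : Type} {e : ι → ModeSpace {m // m ∈ A}}
    {f : κ → ModeSpace {m // m ∉ A}} (he : Orthonormal ℂ e) (hf : Orthonormal ℂ f) :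
    Orthonormal ℂ fun q : ι × κ => tensorVec A (e q.1) (f q.2) := by
  classical
  rw [orthonormal_iff_ite] at he hf ⊢
  rintro ⟨i, k⟩ ⟨i', k'⟩
  rw [inner_tensorVec, he, hf]
  simp only [Prod.mk.injEq, ite_and]
  split_ifs <;> simp

variable {A}

/-- Completeness of the product basis is not needed: the diagonal of `ω` along it sums to `tr σ · tr
τ = 1`, which suffices for computing traces along it. -/
theorem IsProductState.charFn_eq {σ : State (ModeSpace {m // m ∈ A})}
    {τ : State (ModeSpace {m // m ∉ A})} {ω : State (ModeSpace (Fin M))}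
    (h : IsProductState A σ τ ω) (α : Fin M → ℂ) :
    charFn ω α = charFn σ (fun m => α m) * charFn τ (fun m => α m) := by
  set b := orthoBasis (ModeSpace {m // m ∈ A})
  set c := orthoBasis (ModeSpace {m // m ∉ A})
  have h1 := σ.hasSum_opTrace_mul τ (ContinuousLinearMap.id ℂ _) (ContinuousLinearMap.id ℂ _) b c
  rw [σ.opTrace_comp_id, τ.opTrace_comp_id, one_mul] at h1
  have h2 := ω.hasSum_opTrace_of_orthonormal (displacement α)
    (orthonormal_tensorVec A b.orthonormal c.orthonormal) (h1.congr_fun fun q => by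
      rw [h, inner_tensorVec, State.inner_op_right, State.inner_op_right]
      rfl)
  refine h2.unique ((σ.hasSum_opTrace_mul τ (displacement fun m => α m)
    (displacement fun m => α m) b c).congr_fun fun q => ?_)
  rw [h, displacement_tensorVec, inner_tensorVec]

end Tensor

/-! ### Mixtures -/

/-- Operator convergence gives convergence of each diagonal entry only. Absolute summability over
terms and basis vectors together, from the uniform bound 2, lets the trace be summed term by term.
-/
theorem hasSum_charFn_of_hasSum {ι κ : Type} [Fintype ι] {p : κ → ℝ}
    {ω : κ → State (ModeSpace ι)} {ρ : State (ModeSpace ι)} (hp : ∀ j, 0 ≤ p j)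
    (hp' : Summable p) (hρ : HasSum (fun j => (p j : ℂ) • (ω j).op) ρ.op) (α : ι → ℂ) :
    HasSum (fun j => (p j : ℂ) * charFn (ω j) α) (charFn ρ α) := by
  set b := orthoBasis (ModeSpace ι)
  have hle : ∀ j, ∑' i, ‖inner ℂ (b i) ((ω j).op (displacement α (b i)))‖ ≤ 2 := fun j => by
    refine ((ω j).summable_norm_inner (displacement α) b).2.trans ?_
    have := pow_le_one₀ (n := 2) (norm_nonneg _) (opNorm_displacement_le α)
    linarith
  have hsum : Summable fun q : κ × basisSet (ModeSpace ι) =>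
      (p q.1 : ℂ) * inner ℂ (b q.2) ((ω q.1).op (displacement α (b q.2))) := by
    refine Summable.of_norm ?_
    rw [summable_prod_of_nonneg fun q => norm_nonneg _]
    simp only [norm_mul, Complex.norm_real, Real.norm_of_nonneg (hp _), tsum_mul_left]
    refine ⟨fun j => ((ω j).summable_norm_inner (displacement α) b).1.mul_left _, ?_⟩
    refine Summable.of_nonneg_of_le
      (fun j => mul_nonneg (hp j) (tsum_nonneg fun i => norm_nonneg _))
      (fun j => mul_le_mul_of_nonneg_left (hle j) (hp j)) (hp'.mul_right 2)
  obtain ⟨s, hs⟩ := hsum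
  have h1 : HasSum (fun j => (p j : ℂ) * charFn (ω j) α) s :=
    hs.prod_fiberwise fun j => ((ω j).hasSum_opTrace (displacement α) b).mul_left _
  have h2 : HasSum (fun i => inner ℂ (b i) (ρ.op (displacement α (b i)))) s := by
    refine ((Equiv.prodComm _ _).hasSum_iff.2 hs).prod_fiberwise fun i => ?_
    have h3 := (hρ.mapL (ContinuousLinearMap.apply ℂ (ModeSpace ι) (displacement α (b i)))).mapL
      (innerSL ℂ (b i))
    refine h3.congr_fun fun j => ?_
    exact (inner_smul_right (b i) ((ω j).op (displacement α (b i))) (p j : ℂ)).symm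
  have h4 : charFn ρ α = s := (ρ.hasSum_opTrace (displacement α) b).unique h2
  rwa [h4]

/-! ### Positive semidefinite matrices -/

section Matrices

open scoped ComplexOrder

/-- Here `Aᴴ * A = A²`, whose eigenvalues are the squares of those of `A`. The two lists are
compared as root multisets of characteristic polynomials, since their orderings need not agree. -/
theorem traceNorm_eq_trace {N : ℕ} {A : Matrix (Fin N) (Fin N) ℂ} (hA : A.PosSemidef) :
    (traceNorm A : ℂ) = A.trace := by
  have hB := Matrix.isHermitian_conjTranspose_mul_self A
  have hH := hA.isHermitian
  have hsq : Aᴴ * A = cfc (fun x : ℝ => x ^ 2) A := by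
    rw [cfc_pow_id A 2 hH.isSelfAdjoint, hH.eq, sq]
  have h1 := hB.roots_charpoly_eq_eigenvalues
  rw [show (Aᴴ * A).charpoly = _ from (congrArg Matrix.charpoly hsq).trans
    (hH.charpoly_cfc_eq fun x => x ^ 2), Polynomial.roots_prod _ _ (by
      exact Finset.prod_ne_zero_iff.2 fun i _ => Polynomial.X_sub_C_ne_zero _)] at h1
  have h2 := congrArg (fun s : Multiset ℂ => (s.map fun c => √c.re).sum) h1
  simp only [Polynomial.roots_X_sub_C, Multiset.map_map, Multiset.bind_singleton] at h2
  have h3 : ∑ i, √(hH.eigenvalues i ^ 2) = ∑ i, √(hB.eigenvalues i) := h2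
  rw [hH.trace_eq_sum_eigenvalues, traceNorm, ← h3, Complex.ofReal_sum]
  refine Finset.sum_congr rfl fun i _ => ?_
  rw [Real.sqrt_sq (hA.eigenvalues_nonneg i)]
  rfl

theorem posSemidef_hadamard_prod {N : ℕ} {κ : Type} (s : Finset κ)
    {B : κ → Matrix (Fin N) (Fin N) ℂ} (hB : ∀ j, (B j).PosSemidef) :
    (Matrix.of fun n n' => ∏ j ∈ s, B j n n').PosSemidef := by
  classical
  induction s using Finset.induction_on with
  | empty =>
    have h := Matrix.posSemidef_vecMulVec_self_star (fun _ : Fin N => (1 : ℂ))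
    refine (congrArg Matrix.PosSemidef (Matrix.ext fun n n' => ?_)).mp h
    simp [Matrix.vecMulVec_apply]
  | insert j s hj ih =>
    refine (congrArg Matrix.PosSemidef (Matrix.ext fun n n' => ?_)).mp ((hB j).hadamard ih)
    simp [Finset.prod_insert hj]

/-! ### Phase cancellation for product states and mixtures -/

theorem posSemidef_twisted {ι : Type} [Fintype ι] (ρ : State (ModeSpace ι)) {N : ℕ}
    (α : Fin N → ι → ℂ) {ε : ℝ} (hε : ε = -1 ∨ ε = 1) :
    (Matrix.of fun n n' => Complex.exp ((ε * symplecticForm (α n) (α n') : ℝ) * Complex.I) *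
      charFn ρ (α n - α n')).PosSemidef := by
  rcases hε with rfl | rfl
  · simpa using posSemidef_charFn ρ α
  · simpa using posSemidef_charFn' ρ α

theorem exists_signs {L k l : ℕ} (h : L = k + l) :
    ∃ ε : Fin L → ℝ, (∀ j, ε j = -1 ∨ ε j = 1) ∧ ∑ j, ε j = l - k := by
  subst h
  refine ⟨Fin.addCases (fun _ => -1) fun _ => 1, fun j => ?_, ?_⟩
  · refine Fin.addCases (fun i => ?_) (fun i => ?_) j <;> simp
  · simp [Fin.sum_univ_add]
    ring

theorem symplecticForm_const (ζ η : ℂ) :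
    symplecticForm (fun _ : Fin 1 => ζ) (fun _ => η) = ζ.im * η.re - ζ.re * η.im := by
  simp [symplecticForm]

/-- In each mode `ζ ↦ ζ y + ζ^* z` is real-linear with determinant `|y|² - |z|² = 1`, hence
preserves the symplectic form. -/
theorem symplecticForm_bogoliubov {ι : Type} [Fintype ι] {y z : ι → ℂ}
    (hyz : ∀ m, y m * conj (y m) - z m * conj (z m) = 1) (ζ η : ℂ) :
    symplecticForm (fun m => ζ * y m + conj ζ * z m) (fun m => η * y m + conj η * z m) =
      Fintype.card ι * (ζ.im * η.re - ζ.re * η.im) := by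
  rw [symplecticForm, ← nsmul_eq_mul, ← Finset.card_univ, ← Finset.sum_const]
  refine Finset.sum_congr rfl fun m _ => ?_
  have h := congrArg Complex.re (hyz m)
  simp only [Complex.sub_re, Complex.mul_re, Complex.conj_re, Complex.conj_im,
    Complex.one_re] at h
  simp only [Complex.add_re, Complex.add_im, Complex.mul_re, Complex.mul_im, Complex.conj_re,
    Complex.conj_im]
  linear_combination (ζ.im * η.re - ζ.re * η.im) * h

theorem IsProductState.posSemidef_hadamard {M N : ℕ} {A : Finset (Fin M)}
    (hA : A.Nonempty) (hA' : Aᶜ.Nonempty) {σ : State (ModeSpace {m // m ∈ A})}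
    {τ : State (ModeSpace {m // m ∉ A})} {ω : State (ModeSpace (Fin M))}
    (h : IsProductState A σ τ ω) {y z : Fin M → ℂ}
    (hyz : ∀ m, y m * conj (y m) - z m * conj (z m) = 1) (ξ : Fin N → ℂ)
    (r : Fin (M - 2) → State (ModeSpace (Fin 1))) :
    (measuredMatrix ω y z ξ ⊙ kernelMatrix r ξ).PosSemidef := by
  have hc1 : 1 ≤ A.card := hA.card_pos
  have hc2 : 1 ≤ Aᶜ.card := hA'.card_pos
  have hc3 : A.card + Aᶜ.card = M := by
    rw [Finset.card_add_card_compl, Fintype.card_fin]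
  -- Both parts being non-empty makes these counts legitimate; the signs sum to `|A| - |Ā|`.
  obtain ⟨ε, hε, hsum⟩ := exists_signs (show M - 2 = (Aᶜ.card - 1) + (A.card - 1) by omega)
  rw [Nat.cast_sub hc1, Nat.cast_sub hc2, Nat.cast_one, sub_sub_sub_cancel_right] at hsum
  have hcard : Fintype.card {m // m ∈ A} = A.card := by simp
  have hcard' : Fintype.card {m // m ∉ A} = Aᶜ.card := by
    rw [Fintype.card_subtype_compl, Finset.card_compl, Fintype.card_coe]
  let α : Fin N → Fin M → ℂ := fun n m => ξ n * y m + conj (ξ n) * z m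
  have hα : ∀ n n', (fun m => (ξ n - ξ n') * y m + conj (ξ n - ξ n') * z m) = α n - α n' :=
    fun n n' => funext fun m => by
      simp only [α, Pi.sub_apply, map_sub]
      ring
  let αA : Fin N → {m // m ∈ A} → ℂ := fun n m => α n m
  let αB : Fin N → {m // m ∉ A} → ℂ := fun n m => α n m
  have hω : ∀ n n', charFn ω (α n - α n') = charFn σ (αA n - αA n') * charFn τ (αB n - αB n') :=
    fun n n' => h.charFn_eq (α n - α n')
  have h1 := posSemidef_twisted σ αA (Or.inl rfl)
  have h2 := posSemidef_twisted τ αB (Or.inr rfl)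
  have h3 := posSemidef_hadamard_prod Finset.univ fun j =>
    posSemidef_twisted (r j) (fun n _ => ξ n) (hε j)
  have h4 := ((h1.hadamard h2).hadamard h3).smul
    (show (0 : ℂ) ≤ 1 / (N : ℂ) by
      rw [one_div, ← Complex.ofReal_natCast, ← Complex.ofReal_inv]
      exact Complex.zero_le_real.2 (by positivity))
  refine (congrArg Matrix.PosSemidef (Matrix.ext fun n n' => ?_)).mp h4
  have hs1 : symplecticForm (αA n) (αA n') = _ :=
    symplecticForm_bogoliubov (fun m : {m // m ∈ A} => hyz m) (ξ n) (ξ n')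
  have hs2 : symplecticForm (αB n) (αB n') = _ :=
    symplecticForm_bogoliubov (fun m : {m // m ∉ A} => hyz m) (ξ n) (ξ n')
  rw [hcard] at hs1
  rw [hcard'] at hs2
  simp only [Matrix.smul_apply, Matrix.hadamard_apply, Matrix.of_apply, measuredMatrix,
    kernelMatrix, hα, hω, symplecticForm_const, Finset.prod_mul_distrib, smul_eq_mul]
  rw [hs1, hs2, ← Complex.exp_sum, ← Finset.sum_mul, ← Complex.ofReal_sum, ← Finset.sum_mul, hsum]
  set s := (ξ n).im * (ξ n').re - (ξ n).re * (ξ n').im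
  -- The total coefficient of `s` is `-|A| + |Ā| + (|A| - |Ā|) = 0`.
  have hphase : Complex.exp ((-1 * (A.card * s) : ℝ) * Complex.I) *
      Complex.exp ((1 * (Aᶜ.card * s) : ℝ) * Complex.I) *
      Complex.exp (((A.card - Aᶜ.card) * s : ℝ) * Complex.I) = 1 := by
    rw [← Complex.exp_add, ← Complex.exp_add, ← Complex.exp_zero]
    congr 1
    push_cast
    ring
  set a := charFn σ (αA n - αA n')
  set b := charFn τ (αB n - αB n')
  set c := ∏ j, charFn (r j) ((fun _ => ξ n) - fun _ => ξ n')
  change _ = 1 / (N : ℂ) * (a * b) * c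
  linear_combination 1 / (N : ℂ) * a * b * c * hphase

theorem IsBiseparableMixture.posSemidef_hadamard {M N : ℕ} {ρ : State (ModeSpace (Fin M))}
    (hρ : IsBiseparableMixture ρ) {y z : Fin M → ℂ}
    (hyz : ∀ m, y m * conj (y m) - z m * conj (z m) = 1) (ξ : Fin N → ℂ)
    (r : Fin (M - 2) → State (ModeSpace (Fin 1))) :
    (measuredMatrix ρ y z ξ ⊙ kernelMatrix r ξ).PosSemidef := by
  obtain ⟨p, σ, τ, ω, hp, hp1, hprod, hsum⟩ := hρ
  refine posSemidef_of_hasSum (G := fun j => (p j : ℂ) •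
    (measuredMatrix (ω j) y z ξ ⊙ kernelMatrix r ξ)) (fun j => ?_) fun n n' => ?_
  · exact ((hprod j).posSemidef_hadamard j.1.2.1 j.1.2.2 hyz ξ r).smul
      (Complex.zero_le_real.2 (hp j))
  · have h := ((hasSum_charFn_of_hasSum hp hp1.summable hsum fun m =>
      (ξ n - ξ n') * y m + conj (ξ n - ξ n') * z m).mul_left (1 / (N : ℂ))).mul_right
        (kernelMatrix r ξ n n')
    refine h.congr_fun fun j => ?_
    simp only [Matrix.smul_apply, Matrix.hadamard_apply, Matrix.of_apply, measuredMatrix,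
      smul_eq_mul]
    ring

/-- Only differences `ξₙ - ξₙ = 0` occur on the diagonal. The value is left as `N * N⁻¹` so as to
include `N = 0`, where it is 0. -/
theorem trace_measured_hadamard_kernel {M L N : ℕ} (ρ : State (ModeSpace (Fin M)))
    (y z : Fin M → ℂ) (ξ : Fin N → ℂ) (r : Fin L → State (ModeSpace (Fin 1))) :
    (measuredMatrix ρ y z ξ ⊙ kernelMatrix r ξ).trace = N * (N : ℂ)⁻¹ := by
  have h0 : (fun _ : Fin 1 => (0 : ℂ)) = 0 := rfl
  have h1 : (fun _ : Fin M => (0 : ℂ)) = 0 := rfl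
  simp [Matrix.trace, measuredMatrix, kernelMatrix, h0, h1, charFn_zero]

end Matrices

end PhaseSpace

end

theorem mainTheorem3 (M N : ℕ) (hM : 2 ≤ M)
    (ρ : PhaseSpace.State (PhaseSpace.ModeSpace (Fin M)))
    (y z : Fin M → ℂ) (hyz : ∀ m, y m * conj (y m) - z m * conj (z m) = 1)
    (ξ : Fin N → ℂ)
    (r : Fin (M - 2) → PhaseSpace.State (PhaseSpace.ModeSpace (Fin 1)))
    (h : 1 < PhaseSpace.traceNorm
      (PhaseSpace.measuredMatrix ρ y z ξ ⊙ PhaseSpace.kernelMatrix r ξ)) :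
    PhaseSpace.IsGME ρ := by
  intro hρ
  have h1 := PhaseSpace.traceNorm_eq_trace (hρ.posSemidef_hadamard hyz ξ r)
  rw [PhaseSpace.trace_measured_hadamard_kernel] at h1
  have h2 : PhaseSpace.traceNorm
      (PhaseSpace.measuredMatrix ρ y z ξ ⊙ PhaseSpace.kernelMatrix r ξ) = N * (N : ℝ)⁻¹ := by
    refine Complex.ofReal_injective (h1.trans ?_)
    push_cast
    rfl
  rw [h2] at h
  exact absurd h (not_lt.2 (mul_inv_le_one (a := (N : ℝ))))
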